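/- Let $R$ be a noetherian integral domain with fraction field $K$, let $G$ be an arbitrary group, and let $\rho_V : G \to \mathrm{Aut}_K(V)$ be a representation of $G$ on a $K$-vector space $V$ of finite dimension $d \ge 1$. Let $L \subseteq V$ be a $G$-stable $R$-lattice, i.e. a $G$-stable finitely generated $R$-submodule with $KL = V$, and assume that $L$ is free over $R$. For a prime ideal $\mathfrak p$ of $R$ put $k_{\mathfrak p} = R_{\mathfrak p}/\mathfrak p R_{\mathfrak p}$ and $L_{\mathfrak p} = L \otimes_R R_{\mathfrak p}$, and let $\bar\rho_{L,\mathfrak p} : G \to \mathrm{Aut}_{k_{\mathfrak p}}(L_{\mathfrak p}/\mathfrak p L_{\mathfrak p})$ be the representation induced by the action of $G$ on $L$. A representation on a nonzero vector space is called irreducible if its only invariant subspaces are $0$ and the whole space. (1) Suppose that there exists a prime ideal $\mathfrak p$ of $R$ such that (i) $R_{\mathfrak p}$ is a regular local ring and (ii) $\bar\rho_{L,\mathfrak p}$ is irreducible. Then $\rho_V$ is irreducible. (2) If $R$ is a regular domain (i.e. $R_{\mathfrak q}$ is a regular local ring for every prime ideal $\mathfrak q$ of $R$) and there exists a prime ideal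 $\mathfrak p$ of $R$ such that $\bar\rho_{L,\mathfrak p}$ is irreducible, then $\rho_V$ is irreducible. In particular, this holds when $R$ is a Dedekind domain. -/

import Mathlib

open scoped TensorProduct

/-- The `A`-linear representation `ρ_A` on `A ⊗[R] M` obtained by extending an `R`-linear
representation `ρ` on `M` by `A`-linearity: `ρ_A g (a ⊗ m) = a ⊗ ρ g m`. -/
noncomputable def Representation.extendScalars {R G M : Type*} [CommRing R] [Monoid G]
    [AddCommGroup M] [Module R M] (A : Type*) [CommRing A] [Algebra R A]
    (ρ : Representation R G M) : Representation A G (A ⊗[R] M) where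
  toFun g := (ρ g).baseChange A
  map_one' := by ext; simp
  map_mul' g h := by ext; simp

/-- The representation `ρ_L` of `G` on a `G`-stable `R`-submodule `L` of a `K`-vector space `V`
on which `G` acts `K`-linearly through `ρ`. -/
def Representation.onStable {R K G V : Type*} [CommRing R] [Field K] [Algebra R K] [Monoid G]
    [AddCommGroup V] [Module R V] [Module K V] [IsScalarTower R K V]
    (ρ : Representation K G V) (L : Submodule R V) (hL : ∀ g : G, ∀ x ∈ L, ρ g x ∈ L) :
    Representation R G L where
  toFun g := ((ρ g).restrictScalars R).restrict (hL g)
  map_one' := LinearMap.ext fun x => Subtype.ext (LinearMap.congr_fun (map_one ρ) (x : V))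
  map_mul' g h := LinearMap.ext fun x => Subtype.ext (LinearMap.congr_fun (map_mul ρ g h) (x : V))

/-- `M / 𝔪M` as a vector space over the residue field `A / 𝔪` of the local ring `A`. -/
noncomputable instance IsLocalRing.moduleResidueFieldQuotient {A M : Type*} [CommRing A]
    [IsLocalRing A] [AddCommGroup M] [Module A M] :
    Module (IsLocalRing.ResidueField A)
      (M ⧸ IsLocalRing.maximalIdeal A • (⊤ : Submodule A M)) :=
  inferInstanceAs (Module (A ⧸ IsLocalRing.maximalIdeal A)
    (M ⧸ IsLocalRing.maximalIdeal A • (⊤ : Submodule A M)))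

/-- The reduction modulo the maximal ideal `𝔪` of a representation `ρ` over a local ring `A`:
the representation over the residue field `A / 𝔪` induced by `ρ` on `M / 𝔪M`. -/
noncomputable def Representation.modMaximalIdeal {A G M : Type*} [CommRing A] [IsLocalRing A]
    [Monoid G] [AddCommGroup M] [Module A M] (ρ : Representation A G M) :
    Representation (IsLocalRing.ResidueField A) G
      (M ⧸ IsLocalRing.maximalIdeal A • (⊤ : Submodule A M)) where
  toFun g :=
    { toFun := Submodule.mapQ (IsLocalRing.maximalIdeal A • (⊤ : Submodule A M))
        (IsLocalRing.maximalIdeal A • (⊤ : Submodule A M)) (ρ g)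
        (Submodule.smul_top_le_comap_smul_top _ _)
      map_add' := fun x y => map_add _ x y
      map_smul' := by
        intro c x
        obtain ⟨a, rfl⟩ := Ideal.Quotient.mk_surjective c
        exact map_smul (Submodule.mapQ (IsLocalRing.maximalIdeal A • (⊤ : Submodule A M))
          (IsLocalRing.maximalIdeal A • (⊤ : Submodule A M)) (ρ g)
          (Submodule.smul_top_le_comap_smul_top _ _)) a x }
  map_one' := by
    refine LinearMap.ext fun x => ?_
    obtain ⟨m, rfl⟩ := Submodule.Quotient.mk_surjective _ x
    exact congrArg _ (LinearMap.congr_fun (map_one ρ) m)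
  map_mul' g h := by
    refine LinearMap.ext fun x => ?_
    obtain ⟨m, rfl⟩ := Submodule.Quotient.mk_surjective _ x
    exact congrArg _ (LinearMap.congr_fun (map_mul ρ g h) m)

/-- The residual representation `ρ̄_{L,𝔭}` over `k_𝔭 = R_𝔭 / 𝔭R_𝔭`: the reduction modulo `𝔭R_𝔭` of
the representation `ρ_{L,𝔭}` on `L_𝔭 = R_𝔭 ⊗[R] L` obtained from `ρ_L` by extension of scalars. -/
noncomputable def Representation.residual {R K G V : Type*} [CommRing R] [Field K] [Algebra R K]
    [Monoid G] [AddCommGroup V] [Module R V] [Module K V] [IsScalarTower R K V]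
    (ρ : Representation K G V) (L : Submodule R V) (hL : ∀ g : G, ∀ x ∈ L, ρ g x ∈ L)
    (p : Ideal R) [p.IsPrime] :
    Representation (IsLocalRing.ResidueField (Localization.AtPrime p)) G
      ((Localization.AtPrime p ⊗[R] L) ⧸
        IsLocalRing.maximalIdeal (Localization.AtPrime p) •
          (⊤ : Submodule (Localization.AtPrime p) (Localization.AtPrime p ⊗[R] L))) :=
  Representation.modMaximalIdeal (Representation.extendScalars (Localization.AtPrime p) (ρ.onStable L hL))

/-! Write A for the regular local ring R_𝔭 and M for L_𝔭. A nonzero stable subspace W gives a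
nonzero stable submodule N of M, the localization of W ∩ L. It suffices that aM ⊆ N for some a ≠ 0:
then W contains L, hence V. This is `exists_notMem_smul_mem_of_stable` with P = 0, proved by
induction on the embedding dimension of A/P. If it is 0, then P = 𝔪 and irreducibility gives N = M.
Otherwise take a parameter x of A/P and put Q = P + (x). By Krull's intersection theorem, N' = (N :
x^k) is not contained in QM for some k. Induction applied to N' + QM gives a ∉ Q with aM ⊆ N' + xM,
and the determinant trick on M/N' gives b ≡ a^n mod x with bM ⊆ N'. Then x^k b M ⊆ N, and x^k b ∉ P
because P and Q are prime: regular local rings are domains. -/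

section

open IsLocalRing

/-! ### Regular local rings are domains -/

/-- Dividing by an element `x ∈ 𝔪 \ 𝔪²` lowers the minimal number of generators of the maximal
ideal `𝔪`. -/
lemma IsLocalRing.spanFinrank_maximalIdeal_quotient_lt {A : Type*} [CommRing A] [IsLocalRing A]
    [IsNoetherianRing A] {x : A} (hx : x ∈ maximalIdeal A) (hx2 : x ∉ maximalIdeal A ^ 2)
    [IsLocalRing (A ⧸ Ideal.span {x})] :
    (maximalIdeal (A ⧸ Ideal.span {x})).spanFinrank < (maximalIdeal A).spanFinrank := by
  classical
  obtain ⟨s, hs, hspan⟩ :=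
    (IsNoetherian.noetherian (maximalIdeal A)).exists_span_finset_card_eq_spanFinrank
  have hsm : ∀ i ∈ s, i ∈ maximalIdeal A := fun i hi => hspan ▸ Submodule.subset_span hi
  obtain ⟨f, -, hf⟩ := Submodule.mem_span_finset.1 (hspan.symm ▸ hx : x ∈ Submodule.span A (s : Set A))
  -- Since x ∉ 𝔪², its expansion in a minimal generating set has a unit coefficient; that generator
  -- becomes redundant modulo x.
  obtain ⟨i, hi, hu⟩ : ∃ i ∈ s, IsUnit (f i) := by
    by_contra! h
    refine hx2 (hf ▸ Ideal.sum_mem _ fun i hi => ?_)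
    rw [smul_eq_mul, pow_two]
    exact Ideal.mul_mem_mul ((mem_maximalIdeal _).2 (h i hi)) (hsm i hi)
  have hloc : IsLocalHom (Ideal.Quotient.mk (Ideal.span {x})) :=
    .of_surjective _ Ideal.Quotient.mk_surjective
  have hmap : maximalIdeal (A ⧸ Ideal.span {x}) =
      Ideal.span (Ideal.Quotient.mk (Ideal.span {x}) '' (s.erase i : Set A)) := by
    have h1 : maximalIdeal (A ⧸ Ideal.span {x}) =
        (maximalIdeal A).map (Ideal.Quotient.mk (Ideal.span {x})) := by
      rw [← maximalIdeal_comap (Ideal.Quotient.mk (Ideal.span {x})),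
        Ideal.map_comap_of_surjective _ Ideal.Quotient.mk_surjective]
    rw [h1, ← Ideal.map_span]
    refine le_antisymm ?_ (Ideal.map_mono (Ideal.span_le.2 fun j hj =>
      hsm j (Finset.mem_of_mem_erase (Finset.mem_coe.1 hj))))
    rw [← hspan, ← Ideal.span, Ideal.map_span, Ideal.span_le]
    rintro _ ⟨j, hj, rfl⟩
    by_cases hji : j = i
    · subst hji
      rw [← Finset.add_sum_erase _ _ hi] at hf
      have h2 := congrArg (Ideal.Quotient.mk (Ideal.span {x})) hf
      rw [Ideal.Quotient.eq_zero_iff_mem.2 (Ideal.mem_span_singleton_self x), map_add,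
        smul_eq_mul, map_mul] at h2
      refine (Ideal.unit_mul_mem_iff_mem _ (hu.map (Ideal.Quotient.mk (Ideal.span {x})))).1 ?_
      rw [eq_neg_of_add_eq_zero_left h2, neg_mem_iff]
      refine Ideal.mem_map_of_mem _ (Ideal.sum_mem _ fun k hk => ?_)
      exact Ideal.mul_mem_left _ _ (Ideal.subset_span hk)
    · exact Ideal.mem_map_of_mem _ (Ideal.subset_span (by simpa [hji] using hj))
  calc (maximalIdeal (A ⧸ Ideal.span {x})).spanFinrank
      ≤ (Ideal.Quotient.mk (Ideal.span {x}) '' (s.erase i : Set A)).ncard := by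
        rw [hmap]
        exact Submodule.spanFinrank_span_le_ncard_of_finite ((Finset.finite_toSet _).image _)
    _ ≤ (s.erase i : Set A).ncard := Set.ncard_image_le (Finset.finite_toSet _)
    _ = (s.erase i).card := Set.ncard_coe_finset _
    _ < s.card := Finset.card_erase_lt_of_mem hi
    _ = _ := hs

/-- Modulo x the dimension drops by at most one and the number of generators of 𝔪 by at least one,
so generators still do not outnumber the dimension. -/
lemma IsRegularLocalRing.quotient_span_singleton {A : Type*} [CommRing A] [IsRegularLocalRing A]
    {x : A} (hx : x ∈ maximalIdeal A) (hx2 : x ∉ maximalIdeal A ^ 2) :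
    ∃ _ : IsRegularLocalRing (A ⧸ Ideal.span {x}),
      (maximalIdeal (A ⧸ Ideal.span {x})).spanFinrank < (maximalIdeal A).spanFinrank := by
  have : Nontrivial (A ⧸ Ideal.span {x}) := Ideal.Quotient.nontrivial_iff.2 fun h =>
    (Ideal.ne_top_iff_one _).1 (maximalIdeal.isMaximal A).ne_top
      ((Ideal.span_singleton_le_iff_mem _).2 hx (h ▸ Submodule.mem_top))
  have : IsLocalRing (A ⧸ Ideal.span {x}) :=
    .of_surjective' (Ideal.Quotient.mk (Ideal.span {x})) Ideal.Quotient.mk_surjective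
  have hlt := spanFinrank_maximalIdeal_quotient_lt hx hx2
  refine ⟨.of_spanFinrank_maximalIdeal_le _ ?_, hlt⟩
  have h1 := Ideal.height_le_ringKrullDim_quotient_add_one hx
  rw [maximalIdeal_height_eq_ringKrullDim, ← (isRegularLocalRing_iff A).1 ‹_›] at h1
  have h2 : ((maximalIdeal (A ⧸ Ideal.span {x})).spanFinrank : WithBot ℕ∞) + 1 ≤
      ringKrullDim (A ⧸ Ideal.span {x}) + 1 := le_trans (by exact_mod_cast hlt) h1
  generalize ringKrullDim (A ⧸ Ideal.span {x}) = d at h2 ⊢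
  cases d with
  | bot => simp at h2
  | coe d =>
    norm_cast at h2 ⊢
    exact (ENat.add_le_add_iff_right ENat.one_ne_top).1 (by exact_mod_cast h2)

/-- A regular local ring which is not a field has an element of `𝔪 \ 𝔪²` outside all minimal primes. -/
lemma IsRegularLocalRing.exists_parameter {A : Type*} [CommRing A] [IsRegularLocalRing A]
    (h : (maximalIdeal A).spanFinrank ≠ 0) :
    ∃ x ∈ maximalIdeal A, x ∉ maximalIdeal A ^ 2 ∧ ∀ q ∈ minimalPrimes A, x ∉ q := by
  by_contra! H
  have hfin := minimalPrimes.finite_of_isNoetherianRing A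
  have hsub : (maximalIdeal A : Set A) ⊆
      ⋃ q ∈ insert (maximalIdeal A ^ 2) (minimalPrimes A), (q : Set A) := by
    intro x hx
    by_cases hx2 : x ∈ maximalIdeal A ^ 2
    · exact Set.mem_biUnion (Set.mem_insert _ _) hx2
    · obtain ⟨q, hq, hxq⟩ := H x hx hx2
      exact Set.mem_biUnion (Set.mem_insert_of_mem _ hq) hxq
  -- Prime avoidance tolerates two non-prime ideals; here 𝔪² fills both places.
  obtain ⟨q, hq, hle⟩ := (Ideal.subset_union_prime_finite (hfin.insert _) (f := id)
    (maximalIdeal A ^ 2) (maximalIdeal A ^ 2) (fun q hq hne _ =>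
      ((Set.mem_insert_iff.1 hq).resolve_left hne).1.1)).1 hsub
  rcases Set.mem_insert_iff.1 hq with rfl | hq
  · apply h
    have h0 : maximalIdeal A = ⊥ := by
      refine Submodule.eq_bot_of_le_smul_of_le_jacobson_bot (maximalIdeal A) _
        (maximalIdeal A).fg_of_isNoetherianRing (by simpa [pow_two] using hle)
        (maximalIdeal_le_jacobson _)
    rw [h0, Submodule.spanFinrank_bot]
  · have hqm : maximalIdeal A = q :=
      (maximalIdeal.isMaximal A).eq_of_le hq.1.1.ne_top hle
    have hd := (isRegularLocalRing_iff A).1 ‹_›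
    have hh : (maximalIdeal A).height = 0 := by
      have := hq.1.1
      rw [hqm]
      exact Ideal.height_eq_zero_iff.2 hq
    rw [← maximalIdeal_height_eq_ringKrullDim, hh] at hd
    exact h (by exact_mod_cast hd)

/-- By induction (x) is prime for a parameter x. A minimal prime q ⊆ (x) does not contain x, so q =
xq, and Nakayama gives q = 0. -/
theorem IsRegularLocalRing.isDomain (A : Type*) [CommRing A] [IsRegularLocalRing A] :
    IsDomain A := by
  induction hn : (maximalIdeal A).spanFinrank using Nat.strong_induction_on generalizing A with
  | _ n ih =>
  by_cases h : (maximalIdeal A).spanFinrank = 0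
  · rw [Submodule.spanFinrank_eq_zero_iff_eq_bot (maximalIdeal A).fg_of_isNoetherianRing] at h
    exact (isField_iff_maximalIdeal_eq.2 h).isDomain
  obtain ⟨x, hx, hx2, hxq⟩ := exists_parameter h
  obtain ⟨_, hlt⟩ := quotient_span_singleton hx hx2
  have := ih _ (hn ▸ hlt) (A ⧸ Ideal.span {x}) rfl
  have hp : (Ideal.span {x}).IsPrime := (Ideal.Quotient.isDomain_iff_prime _).1 this
  obtain ⟨q, hq, hqx⟩ := Ideal.exists_minimalPrimes_le (bot_le : ⊥ ≤ Ideal.span {x})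
  have hqp : q.IsPrime := hq.1.1
  have hbot : q = ⊥ := by
    refine Submodule.eq_bot_of_le_smul_of_le_jacobson_bot (Ideal.span {x}) _
      q.fg_of_isNoetherianRing (fun y hy => ?_)
      (((Ideal.span_singleton_le_iff_mem _).2 hx).trans (maximalIdeal_le_jacobson _))
    obtain ⟨z, rfl⟩ := Ideal.mem_span_singleton'.1 (hqx hy)
    rw [mul_comm]
    exact Submodule.smul_mem_smul (Ideal.mem_span_singleton_self x)
      ((hqp.mem_or_mem hy).resolve_right (hxq q hq))
  subst hbot
  exact IsDomain.of_bot_isPrime A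

/-! ### Stable submodules over a local ring -/

/-- If `a` maps a finite module `M` into `I • M`, some `b` congruent to a power of `a` modulo `I`
annihilates `M`. -/
lemma Module.Finite.exists_pow_sub_mem_span_annihilator {A M : Type*} [CommRing A] [AddCommGroup M]
    [Module A M] [Module.Finite A M] {a : A} {I : Ideal A}
    (h : ∀ m : M, a • m ∈ I • (⊤ : Submodule A M)) :
    ∃ (n : ℕ) (b : A), b - a ^ n ∈ I ∧ ∀ m : M, b • m = 0 := by
  -- Cayley–Hamilton: p is monic with lower coefficients in I and p(a) kills M, so b = p(a) works.
  obtain ⟨p, hp, -, hc, h0⟩ :=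
    LinearMap.exists_monic_and_natDegree_eq_and_coeff_mem_pow_and_aeval_eq_zero A
      (algebraMap A (Module.End A M) a) I (by rintro _ ⟨m, rfl⟩; exact h m)
  refine ⟨p.natDegree, p.eval a, ?_, fun m => ?_⟩
  · rw [Polynomial.eval_eq_sum_range, Finset.sum_range_succ, hp.coeff_natDegree, one_mul,
      add_sub_cancel_right]
    refine Ideal.sum_mem _ fun i hi => Ideal.mul_mem_right _ _ ?_
    have := Finset.mem_range.1 hi
    exact Ideal.pow_le_self (by omega) (hc i)
  · rw [Polynomial.aeval_algebraMap_apply, Polynomial.coe_aeval_eq_eval] at h0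
    exact LinearMap.congr_fun h0 m

/-- A consequence of Krull's intersection theorem: a submodule `N ⊋ PM` of `M` becomes nonzero
modulo `P + (x)` after dividing by a suitable power of `x`. -/
lemma IsLocalRing.exists_comap_pow_smul_not_le {A M : Type*} [CommRing A] [IsLocalRing A]
    [IsNoetherianRing A] [AddCommGroup M] [Module A M] [Module.Finite A M] {P : Ideal A} {x : A}
    (hx : Ideal.span {x} ≠ ⊤) {N : Submodule A M} (hPN : P • ⊤ ≤ N) (hN : ¬ N ≤ P • ⊤) :
    ∃ k : ℕ, ¬ N.comap (LinearMap.lsmul A M (x ^ k)) ≤ (P ⊔ Ideal.span {x}) • ⊤ := by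
  by_contra! H
  -- If every (N : x^k) lies in PM + xM, each n ∈ N is divisible by all powers of x modulo PM: as PM
  -- ⊆ N, the quotient m lies in (N : x^k), which yields one more factor x.
  have key : ∀ k : ℕ, ∀ n ∈ N, ∃ m : M, n - x ^ k • m ∈ P • (⊤ : Submodule A M) := by
    intro k
    induction k with
    | zero => exact fun n _ => ⟨n, by simp⟩
    | succ k ih =>
      intro n hn
      obtain ⟨m, hm⟩ := ih n hn
      have hmN : x ^ k • m ∈ N := by simpa using N.sub_mem hn (hPN hm)
      have hmQ := H k (show m ∈ N.comap (LinearMap.lsmul A M (x ^ k)) from hmN)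
      rw [Submodule.sup_smul, Submodule.ideal_span_singleton_smul] at hmQ
      obtain ⟨y, hy, z, hz, rfl⟩ := Submodule.mem_sup.1 hmQ
      obtain ⟨w, -, rfl⟩ := (Submodule.mem_smul_pointwise_iff_exists _ _ _).1 hz
      refine ⟨w, ?_⟩
      have : n - x ^ (k + 1) • w = (n - x ^ k • (y + x • w)) + x ^ k • y := by
        rw [pow_succ, mul_smul, smul_add]; abel
      rw [this]
      exact add_mem hm (Submodule.smul_mem _ _ hy)
  refine hN fun n hn => ?_
  rw [← Submodule.Quotient.mk_eq_zero, ← Submodule.mem_bot (R := A),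
    ← Ideal.iInf_pow_smul_eq_bot_of_isLocalRing (Ideal.span {x}) hx, Submodule.mem_iInf]
  intro k
  obtain ⟨m, hm⟩ := key k n hn
  rw [(Submodule.Quotient.eq (P • ⊤ : Submodule A M)).2 hm, Submodule.Quotient.mk_smul]
  exact Submodule.smul_mem_smul (Ideal.pow_mem_pow (Ideal.mem_span_singleton_self x) k) trivial

/-- Let `A` be a noetherian local ring with maximal ideal `𝔪` and `P` an ideal such that `A ⧸ P` is
regular. If `M / 𝔪M` has no nontrivial subspaces stable under the family `φ`, then every
`φ`-stable submodule `N ⊋ PM` contains `aM` for some `a ∉ P`. -/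
theorem IsRegularLocalRing.exists_notMem_smul_mem_of_stable {A M ι : Type*} [CommRing A]
    [IsLocalRing A] [IsNoetherianRing A] [AddCommGroup M] [Module A M] [Module.Finite A M]
    (φ : ι → Module.End A M)
    (hφ : ∀ N : Submodule A M, maximalIdeal A • ⊤ ≤ N → (∀ i, N ≤ N.comap (φ i)) →
      N ≤ maximalIdeal A • ⊤ ∨ N = ⊤)
    (P : Ideal A) [IsRegularLocalRing (A ⧸ P)] {N : Submodule A M} (hPN : P • ⊤ ≤ N)
    (hN : ¬ N ≤ P • ⊤) (hstable : ∀ i, N ≤ N.comap (φ i)) :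
    ∃ a ∉ P, ∀ m : M, a • m ∈ N := by
  induction hn : (maximalIdeal (A ⧸ P)).spanFinrank using Nat.strong_induction_on
    generalizing P N with
  | _ n ih =>
  have hPtop : P ≠ ⊤ := Ideal.Quotient.nontrivial_iff.1 inferInstance
  by_cases h : (maximalIdeal (A ⧸ P)).spanFinrank = 0
  · rw [Submodule.spanFinrank_eq_zero_iff_eq_bot (maximalIdeal _).fg_of_isNoetherianRing] at h
    have hmax : P.IsMaximal := Ideal.Quotient.maximal_of_isField _ (isField_iff_maximalIdeal_eq.2 h)
    obtain rfl := eq_maximalIdeal hmax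
    refine ⟨1, (Ideal.ne_top_iff_one _).1 hPtop, fun m => ?_⟩
    rw [(hφ N hPN hstable).resolve_left hN]
    trivial
  obtain ⟨y, hy, hy2, -⟩ := exists_parameter h
  obtain ⟨_, hlt⟩ := quotient_span_singleton hy hy2
  obtain ⟨x, rfl⟩ := Ideal.Quotient.mk_surjective y
  -- Rewriting the quotient as A/(P + (x)) keeps A and M fixed throughout the induction.
  let e : (A ⧸ P) ⧸ Ideal.span {Ideal.Quotient.mk P x} ≃+* A ⧸ (P ⊔ Ideal.span {x}) :=
    (Ideal.quotEquivOfEq (by rw [Ideal.map_span, Set.image_singleton])).trans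
      (DoubleQuot.quotQuotEquivQuotSup P (Ideal.span {x}))
  have hreg : IsRegularLocalRing (A ⧸ (P ⊔ Ideal.span {x})) := of_ringEquiv e
  rw [← Ideal.spanFinrank_map_eq_of_ringEquiv e, map_ringEquiv_maximalIdeal e, hn] at hlt
  have hxP : x ∉ P := fun hxP => hy2 (by rw [Ideal.Quotient.eq_zero_iff_mem.2 hxP]; exact zero_mem _)
  have hP : P.IsPrime := (Ideal.Quotient.isDomain_iff_prime _).1 (isDomain _)
  have hQ : (P ⊔ Ideal.span {x}).IsPrime := (Ideal.Quotient.isDomain_iff_prime _).1 (isDomain _)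
  obtain ⟨k, hk⟩ := exists_comap_pow_smul_not_le (x := x)
    (fun hx => hQ.ne_top (top_le_iff.1 (hx ▸ le_sup_right))) hPN hN
  set N' := N.comap (LinearMap.lsmul A M (x ^ k)) with hN'
  have hPN' : P • ⊤ ≤ N' := fun m hm => hPN (Submodule.smul_mem _ _ hm)
  have hst' : ∀ i, N' ≤ N'.comap (φ i) := fun i m hm => by
    have := hstable i (show x ^ k • m ∈ N from hm)
    rw [Submodule.mem_comap, map_smul] at this
    exact this
  have hstP : ∀ (I : Ideal A) i, I • ⊤ ≤ (I • ⊤ : Submodule A M).comap (φ i) := fun I i =>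
    Submodule.smul_top_le_comap_smul_top _ _
  obtain ⟨a, haQ, ha⟩ := ih _ hlt (P ⊔ Ideal.span {x})
    (N := N' ⊔ (P ⊔ Ideal.span {x}) • ⊤) le_sup_right (fun hle => hk (le_sup_left.trans hle))
    (fun i => sup_le ((hst' i).trans (Submodule.comap_mono le_sup_left))
      ((hstP _ i).trans (Submodule.comap_mono le_sup_right))) rfl
  -- As PM ⊆ N', only the x-part of Q survives in M/N', so b ≡ a^n' holds modulo (x) alone.
  obtain ⟨n', b, hb, hbM⟩ := Module.Finite.exists_pow_sub_mem_span_annihilator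
    (M := M ⧸ N') (a := a) (I := Ideal.span {x}) (fun m => by
      obtain ⟨m, rfl⟩ := Submodule.Quotient.mk_surjective _ m
      obtain ⟨u, hu, v, hv, huv⟩ := Submodule.mem_sup.1 (ha m)
      rw [Submodule.sup_smul] at hv
      obtain ⟨w, hw, z, hz, rfl⟩ := Submodule.mem_sup.1 hv
      rw [← Submodule.Quotient.mk_smul, ← huv, Submodule.Quotient.mk_add,
        Submodule.Quotient.mk_add, (Submodule.Quotient.mk_eq_zero _).2 hu,
        (Submodule.Quotient.mk_eq_zero _).2 (hPN' hw), zero_add, zero_add]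
      exact Submodule.smul_top_le_comap_smul_top (Ideal.span {x}) N'.mkQ hz)
  have hbQ : b ∉ P ⊔ Ideal.span {x} := fun hb' => haQ (hQ.mem_of_pow_mem n'
    ((Submodule.sub_mem_iff_right _ hb').1 (Ideal.mem_sup_right hb)))
  refine ⟨x ^ k * b, fun hmem => ?_, fun m => ?_⟩
  · rcases hP.mem_or_mem hmem with h1 | h1
    · exact hxP (hP.mem_of_pow_mem k h1)
    · exact hbQ (Ideal.mem_sup_left h1)
  · rw [mul_smul]
    exact (Submodule.Quotient.mk_eq_zero N').1 (by rw [Submodule.Quotient.mk_smul]; exact hbM _)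

/-! ### From the residual representation to V -/

/-- If the reduction of `ρ` modulo `𝔪` is irreducible, the only stable submodules containing `𝔪M`
are `𝔪M` and `M`. -/
lemma Representation.IsIrreducible.eq_top_of_modMaximalIdeal {A G M : Type*} [CommRing A]
    [IsLocalRing A] [Monoid G] [AddCommGroup M] [Module A M] {ρ : Representation A G M}
    (h : ρ.modMaximalIdeal.IsIrreducible) (N : Submodule A M) (hN : maximalIdeal A • ⊤ ≤ N)
    (hst : ∀ g, N ≤ N.comap (ρ g)) : N ≤ maximalIdeal A • ⊤ ∨ N = ⊤ := by
  let S : Subrepresentation ρ.modMaximalIdeal :=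
    { toSubmodule :=
        { (N.map (maximalIdeal A • (⊤ : Submodule A M)).mkQ).toAddSubmonoid with
          smul_mem' := by
            intro c y hy
            obtain ⟨a, rfl⟩ := Ideal.Quotient.mk_surjective c
            exact (N.map (maximalIdeal A • (⊤ : Submodule A M)).mkQ).smul_mem a hy }
      apply_mem_toSubmodule := by
        rintro g _ ⟨n, hn, rfl⟩
        exact ⟨ρ g n, hst g hn, rfl⟩ }
  have hS : ∀ m : M, (maximalIdeal A • (⊤ : Submodule A M)).mkQ m ∈ S → m ∈ N := by
    rintro m ⟨n, hn, hnm⟩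
    have := hN ((Submodule.Quotient.eq _).1 hnm)
    exact (Submodule.sub_mem_iff_right _ hn).1 this
  rcases h.eq_bot_or_eq_top S with h0 | h1
  · refine .inl fun n hn => (Submodule.Quotient.mk_eq_zero _).1 ?_
    have : (maximalIdeal A • (⊤ : Submodule A M)).mkQ n ∈ S := ⟨n, hn, rfl⟩
    rw [h0] at this
    exact this
  · refine .inr (eq_top_iff.2 fun m _ => hS m ?_)
    rw [h1]
    trivial

/-- A representation on a lattice `L` whose residual representation at a prime with regular
localization is irreducible is itself irreducible; `L` need not be free. -/
theorem Representation.isIrreducible_of_residual {R K G V : Type*} [CommRing R] [IsDomain R]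
    [IsNoetherianRing R] [Field K] [Algebra R K] [IsFractionRing R K] [Monoid G]
    [AddCommGroup V] [Module R V] [Module K V] [IsScalarTower R K V] [Nontrivial V]
    (ρ : Representation K G V) (L : Submodule R V) [Submodule.IsLattice K L]
    (hL : ∀ g : G, ∀ x ∈ L, ρ g x ∈ L) (p : Ideal R) [p.IsPrime]
    [IsRegularLocalRing (Localization.AtPrime p)] (h : (ρ.residual L hL p).IsIrreducible) :
    ρ.IsIrreducible := by
  have hinj : Function.Injective (algebraMap R K) := IsFractionRing.injective R K
  have hfin : Module.Finite R L := Module.Finite.iff_fg.2 (Submodule.IsLattice.fg (A := K))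
  have hspan : Submodule.span K (L : Set V) = ⊤ := Submodule.IsLattice.span_eq_top
  have hsmul : ∀ (r : R) (v : V) (W : Submodule K V), r ≠ 0 → r • v ∈ W → v ∈ W :=
    fun r v W hr hv => by
      rw [← algebraMap_smul K] at hv
      exact (W.smul_mem_iff ((map_ne_zero_iff _ hinj).2 hr)).1 hv
  have hp0 : ∀ s : p.primeCompl, (s : R) ≠ 0 := fun s hs => s.2 (hs ▸ p.zero_mem)
  have : Nontrivial (Subrepresentation ρ) := by
    refine ⟨⊥, ⊤, fun hbt => ?_⟩
    exact bot_ne_top (α := Submodule K V) (congrArg Subrepresentation.toSubmodule hbt)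
  refine ⟨fun W => or_iff_not_imp_left.2 fun hW => ?_⟩
  have hW0 : W.toSubmodule ≠ ⊥ := fun h0 => hW (Subrepresentation.toSubmodule_injective h0)
  obtain ⟨w, hwW, hw0⟩ := Submodule.exists_mem_ne_zero_of_ne_bot hW0
  obtain ⟨r, hr, hrw⟩ : ∃ r : R, r ≠ 0 ∧ r • w ∈ L := by
    clear hwW hw0
    have hw : w ∈ Submodule.span K (L : Set V) := hspan ▸ Submodule.mem_top
    induction hw using Submodule.span_induction with
    | mem l hl => exact ⟨1, one_ne_zero, by simpa using hl⟩
    | zero => exact ⟨1, one_ne_zero, by simp⟩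
    | add u v _ _ hu hv =>
      obtain ⟨r, hr, hu⟩ := hu
      obtain ⟨s, hs, hv⟩ := hv
      refine ⟨r * s, mul_ne_zero hr hs, ?_⟩
      rw [smul_add, mul_smul r s v, mul_comm, mul_smul]
      exact L.add_mem (L.smul_mem _ hu) (L.smul_mem _ hv)
    | smul c v _ hv =>
      obtain ⟨r, hr, hv⟩ := hv
      obtain ⟨b, s, hs, rfl⟩ := IsFractionRing.div_surjective (A := R) c
      have hs0 := nonZeroDivisors.ne_zero hs
      refine ⟨s * r, mul_ne_zero hs0 hr, ?_⟩
      have : (s * r) • (algebraMap R K b / algebraMap R K s) • v = b • r • v := by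
        rw [← algebraMap_smul K (s * r), ← algebraMap_smul K b, ← algebraMap_smul K r, smul_smul,
          smul_smul, map_mul]
        congr 1
        have := (map_ne_zero_iff _ hinj).2 hs0
        field_simp
      rw [this]
      exact L.smul_mem _ hv
  let A := Localization.AtPrime p
  let f : L →ₗ[R] A ⊗[R] L := TensorProduct.mk R A L 1
  let N₀ : Submodule R L := (W.toSubmodule.restrictScalars R).comap L.subtype
  let N : Submodule A (A ⊗[R] L) := N₀.localized' A p.primeCompl f
  have hfN : ∀ l ∈ N₀, f l ∈ N := fun l hl =>
    N₀.map_le_localized₀ p.primeCompl f (Submodule.mem_map_of_mem hl)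
  have hmemN : ∀ l : L, f l ∈ N → (l : V) ∈ W.toSubmodule := by
    rintro l ⟨n, hn, s, hs⟩
    rw [IsLocalizedModule.mk'_eq_iff, Submonoid.smul_def, ← map_smul f,
      IsLocalizedModule.eq_iff_exists p.primeCompl] at hs
    obtain ⟨c, hc⟩ := hs
    have hc' : (c : R) • (n : V) = (c : R) • (s : R) • (l : V) := congrArg Subtype.val hc
    refine hsmul s _ _ (hp0 s) (hsmul c _ _ (hp0 c) ?_)
    rw [← hc']
    exact (W.toSubmodule.restrictScalars R).smul_mem _ hn
  have hstable : ∀ g, N ≤ N.comap (Representation.extendScalars A (ρ.onStable L hL) g) := by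
    intro g
    change Submodule.localized' A p.primeCompl f N₀ ≤ _
    rw [Submodule.localized'_eq_span, Submodule.span_le]
    rintro _ ⟨l, hl, rfl⟩
    change Representation.extendScalars A (ρ.onStable L hL) g _ ∈ N
    rw [show Representation.extendScalars A (ρ.onStable L hL) g (f l) =
      f (ρ.onStable L hL g l) from LinearMap.baseChange_tmul _ _ _]
    exact hfN _ (W.apply_mem_toSubmodule g hl)
  have : IsRegularLocalRing (A ⧸ (⊥ : Ideal A)) :=
    IsRegularLocalRing.of_ringEquiv (RingEquiv.quotientBot A).symm
  obtain ⟨a, ha, haN⟩ := IsRegularLocalRing.exists_notMem_smul_mem_of_stable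
    (Representation.extendScalars A (ρ.onStable L hL)) h.eq_top_of_modMaximalIdeal ⊥ (N := N)
    (by simp) (fun hN => by
      have h1 : f ⟨r • w, hrw⟩ ∈ (⊥ : Ideal A) • (⊤ : Submodule A (A ⊗[R] L)) :=
        hN (hfN _ ((W.toSubmodule.restrictScalars R).smul_mem r hwW))
      rw [Submodule.bot_smul, Submodule.mem_bot, IsLocalizedModule.eq_zero_iff p.primeCompl] at h1
      obtain ⟨c, hc⟩ := h1
      have hc' : (c : R) • r • w = 0 := congrArg Subtype.val hc
      exact hw0 ((Submodule.mem_bot K).1 (hsmul r _ _ hr (hsmul c _ _ (hp0 c) (by simp [hc'])))))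
    hstable
  obtain ⟨b, s, rfl⟩ := IsLocalization.exists_mk'_eq p.primeCompl a
  have hb : b ≠ 0 := fun hb => ha (by simp [hb])
  have hLW : ∀ l ∈ L, l ∈ W.toSubmodule := fun l hl => by
    refine hsmul b _ _ hb (hmemN (b • ⟨l, hl⟩) ?_)
    have h2 := N.smul_mem (algebraMap R A s) (haN (f ⟨l, hl⟩))
    rwa [smul_smul, mul_comm, IsLocalization.mk'_spec, algebraMap_smul, ← map_smul] at h2
  refine Subrepresentation.toSubmodule_injective (top_le_iff.1 ?_)
  change ⊤ ≤ W.toSubmodule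
  rw [← hspan]
  exact Submodule.span_le.2 hLW

end

theorem corollary3p8 {R K G V : Type*} [CommRing R] [IsDomain R] [IsNoetherianRing R]
    [Field K] [Algebra R K] [IsFractionRing R K] [Group G]
    [AddCommGroup V] [Module R V] [Module K V] [IsScalarTower R K V]
    [FiniteDimensional K V] [Nontrivial V]
    (ρ : Representation K G V) (L : Submodule R V) [Submodule.IsLattice K L] [Module.Free R L]
    (hL : ∀ g : G, ∀ x ∈ L, ρ g x ∈ L) :
    ((∃ (p : Ideal R) (_ : p.IsPrime),
        IsRegularLocalRing (Localization.AtPrime p) ∧ (ρ.residual L hL p).IsIrreducible) →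
      ρ.IsIrreducible) ∧
    (IsRegularRing R →
      (∃ (p : Ideal R) (_ : p.IsPrime), (ρ.residual L hL p).IsIrreducible) →
      ρ.IsIrreducible) ∧
    (IsDedekindDomain R →
      (∃ (p : Ideal R) (_ : p.IsPrime), (ρ.residual L hL p).IsIrreducible) →
      ρ.IsIrreducible) := by
  refine ⟨fun ⟨p, _, _, h⟩ => ρ.isIrreducible_of_residual L hL p h,
    fun _ ⟨p, _, h⟩ => ρ.isIrreducible_of_residual L hL p h,
    fun _ ⟨p, _, h⟩ => ρ.isIrreducible_of_residual L hL p h⟩
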